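/- For a Hermitian matrix $H\in\mathcal M_N(\mathbb C)$ with eigenvalues $\lambda_1(H)\ge\dots\ge\lambda_N(H)$ (counted with multiplicity), let its spectral spread be the vector $$\mathrm{Spr}^+(H)=\big(\lambda_i(H)-\lambda_{N-i+1}(H)\big)_{1\le i\le \lfloor N/2\rfloor}\in\mathbb R_{\ge0}^{\lfloor N/2\rfloor}.$$ For $B\in\mathcal M_n(\mathbb C)$ let $s(B)=(s_1(B)\ge\dots\ge s_n(B))$ be the vector of its singular values (the eigenvalues of $(B^*B)^{1/2}$, with multiplicity), let $\|B\|$ be its spectral norm, and let $B\oplus B\in\mathcal M_{2n}(\mathbb C)$ be the block diagonal matrix with two diagonal blocks $B$. For $x\in\mathbb R^k$ and $y\in\mathbb R^r$, the product $x\,y$ is the entrywise product $(x_iy_i)_{1\le i\le\min\{k,r\}}$. For $x\in\mathbb R^m$ let $x^\downarrow$ be the vector of its entries in non-increasing order. For $x,y\in\mathbb R^m$, $x\prec_w y$ means that $\sum_{i=1}^j x^\downarrow_i\le\sum_{i=1}^j y^\downarrow_i$ for all $1\le j\le m$; for vectors with non-negative entries and different sizes, $x\prec_w y$ means the same after the shorter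 vector has been completed with zeros. Let $A,X\in\mathcal M_n(\mathbb C)$ be Hermitian. Then $$s(AX-XA)\prec_w \mathrm{Spr}^+(X)\,\mathrm{Spr}^+(A\oplus A).$$ If moreover $X$ is positive semidefinite, then also $$s(AX-XA)\prec_w \tfrac12\,\|X\|\,\mathrm{Spr}^+(A\oplus A).$$ -/

import Mathlib

open scoped ComplexOrder

noncomputable section

namespace SpectralSpread

/-- The rearrangement `x↓` of the entries of a real vector in non-increasing order. -/
def decreasing {k : ℕ} (x : Fin k → ℝ) : Fin k → ℝ :=
  x ∘ Tuple.sort (fun i => -x i)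

/-- `decreasing x` is indeed non-increasing; it is a permutation of `x` by definition. -/
theorem decreasing_antitone {k : ℕ} (x : Fin k → ℝ) : Antitone (decreasing x) := by
  intro i j hij
  have h := Tuple.monotone_sort (fun i => -x i) hij
  simp only [Function.comp_apply, neg_le_neg_iff] at h
  exact h

/-- Submajorization of two real vectors of the same size: each partial sum of `x↓` is at most the
corresponding partial sum of `y↓`. The index `j : Fin k` is zero-based, so that the sums over
`i ≤ j` are the sums of the first `1, …, k` entries. -/
def SubmajorizedEq {k : ℕ} (x y : Fin k → ℝ) : Prop :=
  ∀ j : Fin k, ∑ i ∈ Finset.Iic j, decreasing x i ≤ ∑ i ∈ Finset.Iic j, decreasing y i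

/-- The vector `(x, 0)` of size `m`, for `x` of size `k ≤ m`. -/
def zeroPad {k : ℕ} (m : ℕ) (x : Fin k → ℝ) : Fin m → ℝ :=
  fun i => if h : (i : ℕ) < k then x ⟨i, h⟩ else 0

/-- Submajorization `x ≺_w y` of vectors with non-negative entries, of possibly different sizes:
the shorter of the two is completed with zeros. -/
def Submajorized {k h : ℕ} (x : Fin k → ℝ) (y : Fin h → ℝ) : Prop :=
  SubmajorizedEq (zeroPad (max k h) x) (zeroPad (max k h) y)

/-- The entrywise product of two vectors of possibly different sizes; it has the smaller size. -/
def entrywiseMul {k r : ℕ} (x : Fin k → ℝ) (y : Fin r → ℝ) : Fin (min k r) → ℝ :=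
  fun i => x (i.castLE (min_le_left k r)) * y (i.castLE (min_le_right k r))

/-- The vector of singular values of a complex matrix with columns indexed by `n`, in
non-increasing order and with multiplicity: one value for each column. -/
def singularVector {m n : Type*} [Fintype m] [Fintype n] [DecidableEq m] [DecidableEq n]
    (B : Matrix m n ℂ) : Fin (Fintype.card n) → ℝ :=
  fun i => (Matrix.toEuclideanLin B).singularValues i

/-- The full spectral spread `Spr(A)` of a Hermitian matrix: the entries are
`λ↓ᵢ(A) - λ↑ᵢ(A)`, the eigenvalues being listed with multiplicity
(`eigenvalues₀` is non-increasing). -/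
def fullSpread {n : Type*} [Fintype n] [DecidableEq n] {A : Matrix n n ℂ} (hA : A.IsHermitian) :
    Fin (Fintype.card n) → ℝ :=
  fun i => hA.eigenvalues₀ i - hA.eigenvalues₀ i.rev

/-- The spectral spread `Spr⁺(A)` of a Hermitian matrix of size `N`: the first `[N/2]` entries
of `Spr(A)`. -/
def spread {n : Type*} [Fintype n] [DecidableEq n] {A : Matrix n n ℂ} (hA : A.IsHermitian) :
    Fin (Fintype.card n / 2) → ℝ :=
  fun i => fullSpread hA (i.castLE (Nat.div_le_self _ 2))

/-- The direct sum `A ⊕ B`, the block diagonal matrix with diagonal blocks `A` and `B`. -/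
def directSum {m n : Type*} (A : Matrix m m ℂ) (B : Matrix n n ℂ) : Matrix (m ⊕ n) (m ⊕ n) ℂ :=
  Matrix.fromBlocks A 0 0 B

theorem isHermitian_directSum {m n : Type*} {A : Matrix m m ℂ} {B : Matrix n n ℂ}
    (hA : A.IsHermitian) (hB : B.IsHermitian) : (directSum A B).IsHermitian :=
  Matrix.IsHermitian.fromBlocks hA (by simp) hB

end SpectralSpread

end

noncomputable section

namespace SpectralSpread

open Matrix
open scoped Matrix.Norms.L2Operator

/-! The sum of the first `j` singular values of `C = AX - XA` equals `tr (V C)` for a suitable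
contraction `V` with `|tr (V M)| ≤ j ‖M‖` for all `M` (`exists_trace_mul_eq_sum_singularVector`).
Traces of commutators rotate, `tr (V [A, X]) = tr (X [V, A])`, so each of the Hermitian matrices can
be brought outside a traceless commutator.

The engine is `re_trace_mul_le_sum_spread`. In an eigenbasis of `H`, `tr (H Z)` pairs the decreasing
eigenvalues with the diagonal of `Z`, whose partial sums are traces of `Z` against spectral
projections. If these are at most `T (min m (N - m))`, Abel summation, followed by pairing the
indices `l` and `N - 1 - l`, gives a sum of spreads weighted by increments of `T`.

First inequality: the engine is applied to `X` and then to `A`, which leaves `tr (Q [P, V])` with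
spectral projections `P`, `Q`. A commutator with a projection does not increase the norm, so this
trace is bounded by `min i (N - i)`, `min m (N - m)` and `j`. The result is the stronger bound by
`Spr⁺(X) Spr⁺(A)`; it suffices because `Spr⁺(A ⊕ A)` is `Spr⁺(A)` with doubled entries, up to a
zero.

Second inequality: subtracting the scalar `‖X‖ / 2` from `X` keeps the commutator and leaves a
matrix `Y` with `‖Y‖ ≤ ‖X‖ / 2`; one application of the engine to `A` is then enough. -/

/-- The extension by zero of a finite vector to a sequence. -/
def extendZero {k : ℕ} (x : Fin k → ℝ) (i : ℕ) : ℝ := if h : i < k then x ⟨i, h⟩ else 0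

theorem extendZero_of_le {k : ℕ} (x : Fin k → ℝ) {i : ℕ} (h : k ≤ i) : extendZero x i = 0 :=
  dif_neg (by omega)

theorem extendZero_of_lt {k : ℕ} (x : Fin k → ℝ) {i : ℕ} (h : i < k) :
    extendZero x i = x ⟨i, h⟩ := dif_pos h

theorem extendZero_antitone {k : ℕ} {x : Fin k → ℝ} (hx : Antitone x) (h0 : ∀ i, 0 ≤ x i) :
    Antitone (extendZero x) := by
  intro i j hij
  by_cases hj : j < k
  · rw [extendZero_of_lt x hj, extendZero_of_lt x (hij.trans_lt hj)]
    exact hx hij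
  · rw [extendZero_of_le x (not_lt.1 hj), extendZero]
    split_ifs
    exacts [h0 _, le_rfl]

theorem extendZero_nonneg {k : ℕ} {x : Fin k → ℝ} (h0 : ∀ i, 0 ≤ x i) (i : ℕ) :
    0 ≤ extendZero x i := by
  rw [extendZero]
  split_ifs
  exacts [h0 _, le_rfl]

theorem decreasing_eq_self {k : ℕ} {x : Fin k → ℝ} (hx : Antitone x) : decreasing x = x := by
  have h : Tuple.sort (fun i => -x i) = Equiv.refl _ :=
    Tuple.sort_eq_refl_iff_monotone.2 fun i j hij => neg_le_neg (hx hij)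
  rw [decreasing, h]
  rfl

/-- Submajorization of non-increasing vectors with non-negative entries. -/
theorem submajorized_of_sum_le {k h : ℕ} {x : Fin k → ℝ} {y : Fin h → ℝ} (hx : Antitone x)
    (hx0 : ∀ i, 0 ≤ x i) (hy : Antitone y) (hy0 : ∀ i, 0 ≤ y i)
    (hle : ∀ j, ∑ i ∈ Finset.range j, extendZero x i ≤ ∑ i ∈ Finset.range j, extendZero y i) :
    Submajorized x y := by
  have hpad : ∀ {k m : ℕ} (x : Fin k → ℝ), Antitone x → (∀ i, 0 ≤ x i) →
      Antitone (zeroPad m x) := fun x hx hx0 i j hij => extendZero_antitone hx hx0 hij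
  have hsum : ∀ {k m : ℕ} (x : Fin k → ℝ) (j : Fin m),
      ∑ i ∈ Finset.Iic j, zeroPad m x i = ∑ i ∈ Finset.range (j + 1), extendZero x i := by
    intro k m x j
    rw [Nat.range_succ_eq_Iic, ← Fin.map_valEmbedding_Iic, Finset.sum_map]
    rfl
  intro j
  rw [decreasing_eq_self (hpad x hx hx0), decreasing_eq_self (hpad y hy hy0), hsum, hsum]
  exact hle _

theorem extendZero_entrywiseMul {k r : ℕ} (x : Fin k → ℝ) (y : Fin r → ℝ) (i : ℕ) :
    extendZero (entrywiseMul x y) i = extendZero x i * extendZero y i := by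
  by_cases hi : i < min k r
  · rw [extendZero_of_lt _ hi, extendZero_of_lt _ (lt_min_iff.1 hi).1,
      extendZero_of_lt _ (lt_min_iff.1 hi).2]
    rfl
  · rw [extendZero_of_le _ (not_lt.1 hi)]
    rcases min_le_iff.1 (not_lt.1 hi) with h | h <;> simp [extendZero_of_le _ h]

/-! ### Abel summation and rearrangement of finite sums -/

/-- Abel summation: a sequence with non-negative partial sums, weighted by a decreasing sequence. -/
theorem mul_sum_le_sum_mul (f u : ℕ → ℝ) (N : ℕ) (hf : ∀ i < N, f (i + 1) ≤ f i)
    (hu : ∀ m ≤ N, 0 ≤ ∑ i ∈ Finset.range m, u i) :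
    f N * ∑ i ∈ Finset.range (N + 1), u i ≤ ∑ i ∈ Finset.range (N + 1), f i * u i := by
  induction N with
  | zero => simp
  | succ N ih =>
    have h1 := ih (fun i hi => hf i (by omega)) (fun m hm => hu m (by omega))
    have h2 := mul_le_mul_of_nonneg_right (hf N (by omega)) (hu (N + 1) le_rfl)
    rw [Finset.sum_range_succ _ (N + 1), Finset.sum_range_succ _ (N + 1), mul_add]
    linarith

/-- Equality of the totals kills the boundary term of the Abel summation, so `f` may change sign. -/
theorem sum_mul_le_sum_mul (f g h : ℕ → ℝ) (N : ℕ) (hf : ∀ i, i + 1 < N → f (i + 1) ≤ f i)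
    (hle : ∀ m < N, ∑ i ∈ Finset.range m, g i ≤ ∑ i ∈ Finset.range m, h i)
    (heq : ∑ i ∈ Finset.range N, g i = ∑ i ∈ Finset.range N, h i) :
    ∑ i ∈ Finset.range N, f i * g i ≤ ∑ i ∈ Finset.range N, f i * h i := by
  rcases N with _ | N
  · simp
  have := mul_sum_le_sum_mul f (fun i => h i - g i) N (fun i hi => hf i (by omega))
    (fun m hm => by simpa using hle m (by omega))
  simp only [Finset.sum_sub_distrib, heq, sub_self, mul_zero, mul_sub] at this
  linarith

theorem sum_range_eq_sum_half (F : ℕ → ℝ) (N : ℕ) :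
    ∑ k ∈ Finset.range N, F k =
      ∑ l ∈ Finset.range (N / 2), (F l + F (N - 1 - l)) + if N % 2 = 1 then F (N / 2) else 0 := by
  have key : ∀ p q, ∑ k ∈ Finset.range p, F (q + k) = ∑ k ∈ Finset.range p, F (q + (p - 1 - k)) :=
    fun p q => (Finset.sum_range_reflect (fun k => F (q + k)) p).symm
  rw [Finset.sum_add_distrib]
  rcases Nat.even_or_odd' N with ⟨p, rfl | rfl⟩
  · have h1 : 2 * p / 2 = p := by omega
    rw [h1, if_neg (by omega), two_mul, Finset.sum_range_add, key, add_zero]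
    congr 1
    refine Finset.sum_congr rfl fun k hk => congrArg F ?_
    have := Finset.mem_range.1 hk
    omega
  · have h1 : (2 * p + 1) / 2 = p := by omega
    rw [h1, if_pos (by omega), show 2 * p + 1 = (p + 1) + p by ring, Finset.sum_range_add, key,
      Finset.sum_range_succ, add_right_comm]
    congr 2
    refine Finset.sum_congr rfl fun k hk => congrArg F ?_
    have := Finset.mem_range.1 hk
    omega

/-- The increments of `k ↦ T (min k (N - k))` are antisymmetric under `k ↦ N - 1 - k`; folding the
sum in half turns the weights `f` into differences, and the middle term for odd `N` vanishes. -/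
theorem sum_mul_symmetric (f T : ℕ → ℝ) (N : ℕ) :
    ∑ k ∈ Finset.range N, f k * (T (min (k + 1) (N - (k + 1))) - T (min k (N - k))) =
      ∑ l ∈ Finset.range (N / 2), (f l - f (N - 1 - l)) * (T (l + 1) - T l) := by
  rw [sum_range_eq_sum_half]
  have : (if N % 2 = 1 then f (N / 2) * (T (min (N / 2 + 1) (N - (N / 2 + 1))) -
      T (min (N / 2) (N - N / 2))) else 0) = 0 := by
    split_ifs with h
    · rw [show min (N / 2 + 1) (N - (N / 2 + 1)) = min (N / 2) (N - N / 2) by omega]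
      simp
    · rfl
  rw [this, add_zero]
  refine Finset.sum_congr rfl fun l hl => ?_
  have hl := Finset.mem_range.1 hl
  rw [show min (l + 1) (N - (l + 1)) = l + 1 by omega, show min l (N - l) = l by omega,
    show min (N - 1 - l + 1) (N - (N - 1 - l + 1)) = l by omega,
    show min (N - 1 - l) (N - (N - 1 - l)) = l + 1 by omega]
  ring

theorem sum_range_mul_ite (c : ℕ → ℝ) (M r : ℕ) (hc : ∀ l, M ≤ l → c l = 0) :
    ∑ l ∈ Finset.range M, c l * (if l < r then 1 else 0) = ∑ l ∈ Finset.range r, c l := by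
  simp only [mul_ite, mul_one, mul_zero]
  rw [← Finset.sum_filter]
  refine Finset.sum_subset (fun l hl => ?_) fun l hl hl' => hc l ?_
  · exact Finset.mem_range.2 (Finset.mem_filter.1 hl).2
  · simp only [Finset.mem_filter, Finset.mem_range, not_and] at hl hl'
    by_contra! h
    exact hl' h hl

theorem sum_range_ite_lt (c : ℕ → ℝ) {m N : ℕ} (h : m ≤ N) :
    ∑ i ∈ Finset.range N, (if i < m then c i else 0) = ∑ i ∈ Finset.range m, c i := by
  rw [← Finset.sum_filter]
  congr 1
  ext i
  simp only [Finset.mem_filter, Finset.mem_range]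
  omega

theorem map_range_div_two {M : Type*} (g : ℕ → M) (N : ℕ) :
    (Multiset.range (N + N)).map (fun k => g (k / 2)) =
      (Multiset.range N).map g + (Multiset.range N).map g := by
  induction N with
  | zero => simp
  | succ N ih =>
    rw [show N + 1 + (N + 1) = N + N + 1 + 1 by ring, Multiset.range_succ, Multiset.range_succ,
      Multiset.range_succ]
    simp only [Multiset.map_cons, ih, show (N + N) / 2 = N by omega,
      show (N + N + 1) / 2 = N by omega, Multiset.cons_add, Multiset.add_cons]

theorem map_univ_fin_val {M : Type*} (F : ℕ → M) (N : ℕ) :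
    (Finset.univ : Finset (Fin N)).val.map (fun k : Fin N => F k) = (Multiset.range N).map F := by
  have h := congrArg Finset.val (Fin.map_valEmbedding_univ (n := N))
  rw [Finset.map_val, Nat.Iio_eq_range, Finset.range_val] at h
  rw [← h, Multiset.map_map]
  rfl

theorem isSymmetric_eigenvalues_congr {E : Type*} [NormedAddCommGroup E] [InnerProductSpace ℂ E]
    [FiniteDimensional ℂ E] {S T : E →ₗ[ℂ] E} (hS : S.IsSymmetric) (hT : T.IsSymmetric) (h : S = T)
    {m : ℕ} (hm : Module.finrank ℂ E = m) (i : Fin m) :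
    hS.eigenvalues hm i = hT.eigenvalues hm i := by
  subst h
  rfl

/-! ### Eigenvalue positions and cyclic traces -/

variable {ι : Type*} [Fintype ι]

/-- The position of an index in the enumeration that orders the eigenvalues. -/
def position (k : ι) : ℕ :=
  ((Fintype.equivOfCardEq (Fintype.card_fin _) : Fin (Fintype.card ι) ≃ ι).symm k : ℕ)

theorem position_lt (k : ι) : position k < Fintype.card ι := Fin.is_lt _

theorem sum_position {M : Type*} [AddCommMonoid M] (f : ℕ → M) :
    ∑ k : ι, f (position k) = ∑ i ∈ Finset.range (Fintype.card ι), f i := by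
  rw [Finset.sum_range]
  exact Equiv.sum_comp (Fintype.equivOfCardEq (Fintype.card_fin _) :
    Fin (Fintype.card ι) ≃ ι).symm (fun i => f i)

theorem card_position_lt_le (m : ℕ) :
    (Finset.univ.filter fun k : ι => position k < m).card ≤ m := by
  rw [Finset.card_filter, sum_position (fun i => if i < m then 1 else 0), ← Finset.card_filter]
  refine (Finset.card_le_card (t := Finset.range m) fun i hi => ?_).trans_eq (Finset.card_range m)
  simpa using (Finset.mem_filter.1 hi).2

theorem card_le_position_le (m : ℕ) :
    (Finset.univ.filter fun k : ι => ¬ position k < m).card ≤ Fintype.card ι - m := by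
  rw [Finset.card_filter, sum_position (fun i => if ¬ i < m then 1 else 0), ← Finset.card_filter]
  refine (Finset.card_le_card (t := Finset.Ico m (Fintype.card ι)) fun i hi => ?_).trans_eq
    (Nat.card_Ico _ _)
  simp only [Finset.mem_filter, Finset.mem_range, not_lt] at hi
  simpa using hi.symm

theorem trace_commutator (M N : Matrix ι ι ℂ) : (M * N - N * M).trace = 0 := by
  rw [trace_sub, trace_mul_comm, sub_self]

/-- The trace of a triple commutator product is invariant under cyclic permutations. -/
theorem trace_mul_commutator (P M N : Matrix ι ι ℂ) :
    (P * (M * N - N * M)).trace = (N * (P * M - M * P)).trace := by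
  rw [mul_sub, mul_sub, trace_sub, trace_sub, ← mul_assoc, trace_mul_comm (P * M) N,
    trace_mul_comm P (N * M), mul_assoc N M P]

variable [DecidableEq ι]

/-- Entries of a matrix are bounded by its spectral norm. -/
theorem norm_entry_le_l2_opNorm (M : Matrix ι ι ℂ) (i j : ι) : ‖M i j‖ ≤ ‖M‖ := by
  have h := l2_opNorm_mulVec M (EuclideanSpace.single j 1)
  have h2 := PiLp.norm_apply_le ((EuclideanSpace.equiv ι ℂ).symm
    (M *ᵥ (EuclideanSpace.single j (1 : ℂ)))) i
  simp only [PiLp.norm_single, norm_one, mul_one] at h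
  refine le_trans ?_ (h2.trans h)
  simp

/-! ### Unitary diagonalization and spectral projections -/

/-- The matrix with eigenvectors the columns of `U` and eigenvalues `v`. -/
def conjDiag (U : unitaryGroup ι ℂ) (v : ι → ℂ) : Matrix ι ι ℂ :=
  (U : Matrix ι ι ℂ) * diagonal v * star (U : Matrix ι ι ℂ)

theorem conjDiag_mul (U : unitaryGroup ι ℂ) (v w : ι → ℂ) :
    conjDiag U v * conjDiag U w = conjDiag U (v * w) := by
  have h : star (U : Matrix ι ι ℂ) * (U : Matrix ι ι ℂ) = 1 := Unitary.coe_star_mul_self U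
  have : conjDiag U v * conjDiag U w = (U : Matrix ι ι ℂ) * diagonal v *
      (star (U : Matrix ι ι ℂ) * (U : Matrix ι ι ℂ)) * diagonal w * star (U : Matrix ι ι ℂ) := by
    simp only [conjDiag, mul_assoc]
  rw [this, h, mul_one, mul_assoc (U : Matrix ι ι ℂ), diagonal_mul_diagonal']
  rfl

theorem conjDiag_one (U : unitaryGroup ι ℂ) : conjDiag U 1 = 1 := by
  have h : (U : Matrix ι ι ℂ) * star (U : Matrix ι ι ℂ) = 1 := Unitary.coe_mul_star_self U
  simp only [conjDiag, Pi.one_def, diagonal_one, mul_one, h]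

theorem conjDiag_sub (U : unitaryGroup ι ℂ) (v w : ι → ℂ) :
    conjDiag U (v - w) = conjDiag U v - conjDiag U w := by
  have h : diagonal (v - w) = diagonal v - diagonal w := (diagonal_sub v w).symm
  simp only [conjDiag, h, mul_sub, sub_mul]

theorem conjDiag_smul (U : unitaryGroup ι ℂ) (c : ℂ) (v : ι → ℂ) :
    conjDiag U (c • v) = c • conjDiag U v := by
  simp [conjDiag, diagonal_smul]

theorem star_conjDiag (U : unitaryGroup ι ℂ) (v : ι → ℂ) :
    (conjDiag U v)ᴴ = conjDiag U (star v) := by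
  simp [conjDiag, conjTranspose_mul, star_eq_conjTranspose, mul_assoc]

theorem norm_conjDiag_le (U : unitaryGroup ι ℂ) {v : ι → ℂ} {c : ℝ} (hc : 0 ≤ c)
    (h : ∀ k, ‖v k‖ ≤ c) : ‖conjDiag U v‖ ≤ c := by
  rw [conjDiag, ← Unitary.coe_star, CStarRing.norm_mul_coe_unitary, CStarRing.norm_coe_unitary_mul,
    l2_opNorm_diagonal]
  exact (pi_norm_le_iff_of_nonneg hc).2 h

/-- The diagonal entries of `M` in the orthonormal basis of the columns of `U`. -/
def diagEntry (U : unitaryGroup ι ℂ) (M : Matrix ι ι ℂ) (k : ι) : ℂ :=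
  (star (U : Matrix ι ι ℂ) * M * (U : Matrix ι ι ℂ)) k k

theorem norm_diagEntry_le (U : unitaryGroup ι ℂ) (M : Matrix ι ι ℂ) (k : ι) :
    ‖diagEntry U M k‖ ≤ ‖M‖ := by
  refine (norm_entry_le_l2_opNorm _ k k).trans ?_
  rw [← Unitary.coe_star, CStarRing.norm_mul_coe_unitary, CStarRing.norm_coe_unitary_mul]

theorem trace_conjDiag_mul (U : unitaryGroup ι ℂ) (v : ι → ℂ) (M : Matrix ι ι ℂ) :
    (conjDiag U v * M).trace = ∑ k, v k * diagEntry U M k := by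
  have : (conjDiag U v * M).trace =
      (diagonal v * (star (U : Matrix ι ι ℂ) * M * (U : Matrix ι ι ℂ))).trace := by
    rw [conjDiag, mul_assoc, mul_assoc, trace_mul_comm]
    simp only [mul_assoc]
  rw [this, trace]
  simp [diagEntry, diagonal_mul]

theorem trace_eq_sum_diagEntry (U : unitaryGroup ι ℂ) (M : Matrix ι ι ℂ) :
    M.trace = ∑ k, diagEntry U M k := by
  simpa [conjDiag_one] using trace_conjDiag_mul U 1 M

theorem isHermitian_eq_conjDiag {H : Matrix ι ι ℂ} (hH : H.IsHermitian) :
    H = conjDiag hH.eigenvectorUnitary (fun k => (hH.eigenvalues k : ℂ)) := by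
  conv_lhs => rw [hH.spectral_theorem]
  rfl

theorem eigenvalues_eq_extendZero {H : Matrix ι ι ℂ} (hH : H.IsHermitian) (k : ι) :
    hH.eigenvalues k = extendZero hH.eigenvalues₀ (position k) := by
  rw [extendZero, dif_pos (position_lt k)]
  rfl

/-- The spectral projection onto the span of the first `m` columns of `U`, the columns being
ordered by `position`. -/
def spectralProj (U : unitaryGroup ι ℂ) (m : ℕ) : Matrix ι ι ℂ :=
  conjDiag U (fun k => if position k < m then 1 else 0)

theorem trace_spectralProj_mul (U : unitaryGroup ι ℂ) (m : ℕ) (M : Matrix ι ι ℂ) :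
    (spectralProj U m * M).trace = ∑ k with position k < m, diagEntry U M k := by
  rw [spectralProj, trace_conjDiag_mul, Finset.sum_filter]
  simp

theorem norm_sum_diagEntry_le (U : unitaryGroup ι ℂ) (M : Matrix ι ι ℂ) (s : Finset ι) :
    ‖∑ k ∈ s, diagEntry U M k‖ ≤ s.card * ‖M‖ := by
  refine (norm_sum_le _ _).trans ?_
  simpa using Finset.sum_le_card_nsmul s _ _ fun k _ => norm_diagEntry_le U M k

theorem norm_trace_spectralProj_mul_le (U : unitaryGroup ι ℂ) (m : ℕ) (M : Matrix ι ι ℂ) :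
    ‖(spectralProj U m * M).trace‖ ≤ m * ‖M‖ := by
  rw [trace_spectralProj_mul]
  refine (norm_sum_diagEntry_le U M _).trans ?_
  gcongr
  exact card_position_lt_le m

/-- For a traceless matrix, the complement of the projection gives a second bound. -/
theorem norm_trace_spectralProj_mul_le_of_trace_eq_zero (U : unitaryGroup ι ℂ) (m : ℕ)
    {M : Matrix ι ι ℂ} (hM : M.trace = 0) :
    ‖(spectralProj U m * M).trace‖ ≤ (min m (Fintype.card ι - m) : ℕ) * ‖M‖ := by
  have h1 := norm_trace_spectralProj_mul_le U m M
  have h2 : ‖(spectralProj U m * M).trace‖ ≤ ((Fintype.card ι - m : ℕ) : ℝ) * ‖M‖ := by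
    have h3 := Finset.sum_filter_add_sum_filter_not Finset.univ (fun k : ι => position k < m)
      (diagEntry U M)
    rw [← trace_eq_sum_diagEntry, hM, ← trace_spectralProj_mul] at h3
    rw [eq_neg_of_add_eq_zero_left h3, norm_neg]
    refine (norm_sum_diagEntry_le U M _).trans ?_
    gcongr
    exact card_le_position_le m
  rcases min_choice m (Fintype.card ι - m) with h | h <;> rw [h] <;> assumption

/-- Commuting with a projection is, up to a factor `1/2`, commuting with a reflection. -/
theorem norm_spectralProj_commutator_le (U : unitaryGroup ι ℂ) (m : ℕ) (M : Matrix ι ι ℂ) :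
    ‖spectralProj U m * M - M * spectralProj U m‖ ≤ ‖M‖ := by
  set R : Matrix ι ι ℂ := (2 : ℂ) • spectralProj U m - 1 with hR
  have hR1 : ‖R‖ ≤ 1 := by
    rw [hR, spectralProj, ← conjDiag_smul, ← conjDiag_one U, ← conjDiag_sub]
    refine norm_conjDiag_le U zero_le_one fun k => ?_
    by_cases h : position k < m <;> norm_num [h]
  have h2 : (2 : ℂ) • (spectralProj U m * M - M * spectralProj U m) = R * M - M * R := by
    simp only [hR, sub_mul, mul_sub, smul_mul_assoc, mul_smul_comm, one_mul, mul_one, smul_sub]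
    abel
  have h3 := congrArg norm h2
  rw [norm_smul, Complex.norm_ofNat] at h3
  have h4 : ‖R * M - M * R‖ ≤ 2 * ‖M‖ := by
    refine (norm_sub_le _ _).trans ?_
    have h5 := (norm_mul_le R M).trans (mul_le_mul_of_nonneg_right hR1 (norm_nonneg M))
    have h6 := (norm_mul_le M R).trans (mul_le_mul_of_nonneg_left hR1 (norm_nonneg M))
    linarith
  linarith

/-! ### Spectral spread and the trace inequality -/

theorem extendZero_spread {H : Matrix ι ι ℂ} (hH : H.IsHermitian) {l : ℕ}
    (hl : l < Fintype.card ι / 2) :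
    extendZero (spread hH) l = extendZero hH.eigenvalues₀ l -
      extendZero hH.eigenvalues₀ (Fintype.card ι - 1 - l) := by
  rw [extendZero_of_lt _ hl, extendZero_of_lt _ (show l < Fintype.card ι by omega),
    extendZero_of_lt _ (show Fintype.card ι - 1 - l < Fintype.card ι by omega), spread, fullSpread]
  congr 2
  ext
  simp only [Fin.val_rev, Fin.val_castLE]
  omega

theorem spread_antitone {H : Matrix ι ι ℂ} (hH : H.IsHermitian) : Antitone (spread hH) := by
  intro i j hij
  refine sub_le_sub (hH.eigenvalues₀_antitone hij) (hH.eigenvalues₀_antitone ?_)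
  exact Fin.rev_le_rev.2 hij

theorem spread_nonneg {H : Matrix ι ι ℂ} (hH : H.IsHermitian) (i) : 0 ≤ spread hH i := by
  refine sub_nonneg.2 (hH.eigenvalues₀_antitone ?_)
  have := i.2
  rw [Fin.le_def, Fin.val_rev, Fin.val_castLE]
  omega

/-- The trace of a Hermitian matrix against a traceless matrix is controlled by the spectral spread
and by the traces against spectral projections. -/
theorem re_trace_mul_le_sum_spread {H Z : Matrix ι ι ℂ} (hH : H.IsHermitian) (hZ : Z.trace = 0)
    (T : ℕ → ℝ) (hT : T 0 = 0)
    (hle : ∀ (U : unitaryGroup ι ℂ) (m : ℕ),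
      (spectralProj U m * Z).trace.re ≤ T (min m (Fintype.card ι - m))) :
    (H * Z).trace.re ≤
      ∑ l ∈ Finset.range (Fintype.card ι / 2), extendZero (spread hH) l * (T (l + 1) - T l) := by
  set N := Fintype.card ι with hN
  set U := hH.eigenvectorUnitary
  let d : ℕ → ℝ := extendZero fun i : Fin N =>
    (diagEntry U Z (Fintype.equivOfCardEq (Fintype.card_fin _) i)).re
  have hd : ∀ k, (diagEntry U Z k).re = d (position k) := fun k => by
    simp only [d, extendZero_of_lt _ (position_lt k)]
    simp [position]
  have hsum : ∀ m ≤ N, ∑ i ∈ Finset.range m, d i = (spectralProj U m * Z).trace.re := by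
    intro m hm
    rw [trace_spectralProj_mul, Complex.re_sum, Finset.sum_filter, ← sum_range_ite_lt d hm,
      ← sum_position]
    simp only [hd]
  have htot : ∑ i ∈ Finset.range N, d i = 0 := by
    rw [← sum_position]
    simp only [← hd, ← Complex.re_sum, ← trace_eq_sum_diagEntry, hZ, Complex.zero_re]
  have hHZ : (H * Z).trace.re =
      ∑ k ∈ Finset.range N, extendZero hH.eigenvalues₀ k * d k := by
    conv_lhs => rw [isHermitian_eq_conjDiag hH]
    rw [trace_conjDiag_mul, Complex.re_sum,
      ← sum_position (fun k => extendZero hH.eigenvalues₀ k * d k)]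
    simp only [Complex.re_ofReal_mul, ← hd, eigenvalues_eq_extendZero]
    rfl
  -- The comparison sequence is chosen so that its partial sums are exactly the assumed bounds; its
  -- total is `T 0 = 0`, matching `tr Z = 0`.
  have htel : ∀ m, ∑ k ∈ Finset.range m,
      (T (min (k + 1) (N - (k + 1))) - T (min k (N - k))) = T (min m (N - m)) := fun m => by
    rw [Finset.sum_range_sub (fun k => T (min k (N - k)))]
    simp [hT]
  rw [Finset.sum_congr rfl fun l hl => by rw [extendZero_spread hH (Finset.mem_range.1 hl)],
    ← sum_mul_symmetric, hHZ]
  refine sum_mul_le_sum_mul _ _ _ _ (fun i hi => ?_) (fun m hm => ?_) ?_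
  · rw [extendZero_of_lt _ hi, extendZero_of_lt _ ((Nat.lt_succ_self i).trans hi)]
    exact hH.eigenvalues₀_antitone (Nat.le_succ i)
  · rw [htel, hsum m hm.le]
    exact hle U m
  · rw [htel, htot]
    simp [hT]

/-! ### Spectrum of the direct sum -/

theorem roots_charpoly_map_re {H : Matrix ι ι ℂ} (hH : H.IsHermitian) :
    H.charpoly.roots.map RCLike.re =
      (Multiset.range (Fintype.card ι)).map (extendZero hH.eigenvalues₀) := by
  rw [hH.roots_charpoly_eq_eigenvalues₀, Multiset.map_map, ← map_univ_fin_val]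
  refine Multiset.map_congr rfl fun k _ => ?_
  simp [extendZero_of_lt]

/-- The eigenvalues of `A ⊕ A` are those of `A`, each of them repeated twice. -/
theorem eigenvalues₀_directSum_self {A : Matrix ι ι ℂ} (hA : A.IsHermitian) (k : ℕ) :
    extendZero (isHermitian_directSum hA hA).eigenvalues₀ k =
      extendZero hA.eigenvalues₀ (k / 2) := by
  have hcard : Fintype.card (ι ⊕ ι) = Fintype.card ι + Fintype.card ι := Fintype.card_sum
  by_cases hk : k < Fintype.card (ι ⊕ ι)
  swap
  · rw [extendZero_of_le _ (not_lt.1 hk), extendZero_of_le _ (by omega)]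
  set f : Fin (Fintype.card (ι ⊕ ι)) → ℝ := fun i => extendZero hA.eigenvalues₀ (i / 2) with hf
  suffices h : (isHermitian_directSum hA hA).eigenvalues₀ = f by
    rw [extendZero_of_lt _ hk, h]
  have hanti : Antitone f := by
    intro i j hij
    have hi := i.2
    have hj := j.2
    have hij' : (i : ℕ) ≤ j := hij
    simp only [hf]
    rw [extendZero_of_lt _ (show (j : ℕ) / 2 < Fintype.card ι by omega),
      extendZero_of_lt _ (show (i : ℕ) / 2 < Fintype.card ι by omega)]
    exact hA.eigenvalues₀_antitone (Fin.mk_le_mk.2 (by omega))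
  have hroots : (directSum A A).charpoly.roots.map RCLike.re = (List.ofFn f : Multiset ℝ) := by
    rw [directSum, charpoly_fromBlocks_zero₁₂,
      Polynomial.roots_mul (mul_ne_zero A.charpoly_monic.ne_zero A.charpoly_monic.ne_zero),
      Multiset.map_add, roots_charpoly_map_re hA, ← map_range_div_two, ← hcard,
      ← map_univ_fin_val, Fin.univ_val_map]
  -- The list of `eigenvalues₀` is the sorted list of characteristic roots, and `f` is already
  -- sorted.
  rw [← List.ofFn_inj, ← (isHermitian_directSum hA hA).sort_roots_charpoly_eq_eigenvalues₀, hroots,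
    Multiset.coe_sort]
  apply List.mergeSort_of_pairwise
  simp_rw [decide_eq_true_eq, ← List.sortedGE_iff_pairwise]
  exact hanti.sortedGE_ofFn

theorem spread_directSum_self {A : Matrix ι ι ℂ} (hA : A.IsHermitian) (k : ℕ) :
    extendZero (spread (isHermitian_directSum hA hA)) k = extendZero (spread hA) (k / 2) := by
  have hcard : Fintype.card (ι ⊕ ι) = Fintype.card ι + Fintype.card ι := Fintype.card_sum
  by_cases hk : k < Fintype.card (ι ⊕ ι) / 2
  swap
  · rw [extendZero_of_le _ (not_lt.1 hk), extendZero_of_le _ (by omega)]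
  rw [extendZero_spread _ hk, eigenvalues₀_directSum_self, eigenvalues₀_directSum_self,
    show (Fintype.card (ι ⊕ ι) - 1 - k) / 2 = Fintype.card ι - 1 - k / 2 by omega]
  by_cases hk' : k / 2 < Fintype.card ι / 2
  · rw [extendZero_spread _ hk']
  -- Here the size of `A` is odd and `k / 2` is its middle index: the extra entry is an eigenvalue
  -- minus itself.
  · rw [extendZero_of_le (spread hA) (not_lt.1 hk'),
      show Fintype.card ι - 1 - k / 2 = k / 2 by omega, sub_self]

/-! ### Singular values as traces -/

theorem eigenvalues₀_conjTranspose_mul_self (C : Matrix ι ι ℂ) (i : ℕ) :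
    extendZero (isHermitian_conjTranspose_mul_self C).eigenvalues₀ i =
      extendZero (singularVector C) i ^ 2 := by
  by_cases hi : i < Fintype.card ι
  swap
  · simp [extendZero_of_le _ (not_lt.1 hi)]
  have hadj : LinearMap.adjoint (toEuclideanLin C) ∘ₗ toEuclideanLin C =
      toEuclideanLin (Cᴴ * C) := by
    rw [← toEuclideanLin_conjTranspose_eq_adjoint]
    exact (toLpLin_mul_same 2 Cᴴ C).symm
  have hsq := (toEuclideanLin C).sq_singularValues_fin finrank_euclideanSpace ⟨i, hi⟩
  rw [isSymmetric_eigenvalues_congr _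
    (isSymmetric_toEuclideanLin_iff.mpr (isHermitian_conjTranspose_mul_self C)) hadj] at hsq
  rw [extendZero_of_lt _ hi, extendZero_of_lt _ hi]
  exact hsq.symm

theorem singularVector_nonneg (C : Matrix ι ι ℂ) (i) : 0 ≤ singularVector C i :=
  LinearMap.singularValues_nonneg _ _

theorem singularVector_antitone (C : Matrix ι ι ℂ) : Antitone (singularVector C) :=
  fun _ _ h => LinearMap.singularValues_antitone _ h

/-- The sum of the first `j` singular values of `C` is the trace of `C` against a contraction of
trace norm at most `j`. -/
theorem exists_trace_mul_eq_sum_singularVector (C : Matrix ι ι ℂ) (j : ℕ) :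
    ∃ V : Matrix ι ι ℂ, ‖V‖ ≤ 1 ∧ (∀ M, ‖(V * M).trace‖ ≤ j * ‖M‖) ∧
      (V * C).trace = ((∑ i ∈ Finset.range j, extendZero (singularVector C) i : ℝ) : ℂ) := by
  set hH := isHermitian_conjTranspose_mul_self C
  set U := hH.eigenvectorUnitary
  set σ := extendZero (singularVector C) with hσ
  have hσ0 : ∀ i, 0 ≤ σ i := extendZero_nonneg (singularVector_nonneg C)
  -- Inverse singular values, cut off at `j`; since `0⁻¹ = 0`, the matrix `conjDiag U e * Cᴴ` is a
  -- partial isometry even when `C` is singular.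
  let e : ι → ℂ := fun k => if position k < j then ((σ (position k))⁻¹ : ℝ) else 0
  have hCC : Cᴴ * C = conjDiag U fun k => ((σ (position k) ^ 2 : ℝ) : ℂ) := by
    rw [isHermitian_eq_conjDiag hH]
    simp only [eigenvalues_eq_extendZero, eigenvalues₀_conjTranspose_mul_self, hσ]
    rfl
  have hV : ‖conjDiag U e * Cᴴ‖ ≤ 1 := by
    have h : ‖conjDiag U e * Cᴴ‖ * ‖conjDiag U e * Cᴴ‖ ≤ 1 := by
      -- With `V` this matrix, `V Vᴴ` is diagonal in the basis `U`, with entries `σ⁻¹ σ² σ⁻¹`, hence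
      -- 0 or 1.
      rw [← CStarRing.norm_self_mul_star, star_eq_conjTranspose, conjTranspose_mul,
        conjTranspose_conjTranspose, star_conjDiag, mul_assoc, ← mul_assoc Cᴴ, hCC, conjDiag_mul,
        conjDiag_mul]
      refine norm_conjDiag_le U zero_le_one fun k => ?_
      simp only [Pi.mul_apply, Pi.star_apply, e]
      split_ifs with hk
      · rcases eq_or_ne (σ (position k)) 0 with h0 | h0
        · simp [h0]
        · have : (σ (position k) : ℂ) ≠ 0 := by exact_mod_cast h0
          simp only [Complex.ofReal_inv, Complex.ofReal_pow, star_inv₀, RCLike.star_def,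
            Complex.conj_ofReal]
          field_simp
          simp
      · simp
    nlinarith [norm_nonneg (conjDiag U e * Cᴴ)]
  refine ⟨conjDiag U e * Cᴴ, hV, fun M => ?_, ?_⟩
  -- `V` factors through a projection of rank at most `j`, hence the bound `j ‖M‖`.
  · have hP : spectralProj U j * (conjDiag U e * Cᴴ) = conjDiag U e * Cᴴ := by
      rw [← mul_assoc, spectralProj, conjDiag_mul]
      congr 2
      ext k
      simp only [Pi.mul_apply, e]
      split_ifs <;> simp
    rw [← hP, mul_assoc]
    refine (norm_trace_spectralProj_mul_le U j _).trans ?_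
    gcongr
    exact (norm_mul_le _ _).trans (mul_le_of_le_one_left (norm_nonneg M) hV)
  · have htr : ∀ v : ι → ℂ, (conjDiag U v).trace = ∑ k, v k := fun v => by
      rw [conjDiag, trace_mul_comm, ← mul_assoc, Unitary.coe_star_mul_self, one_mul, trace_diagonal]
    rw [mul_assoc, hCC, conjDiag_mul, htr,
      ← sum_range_mul_ite σ (Fintype.card ι) j (fun l hl => extendZero_of_le _ hl),
      ← sum_position (fun i => σ i * if i < j then 1 else 0), Complex.ofReal_sum]
    refine Finset.sum_congr rfl fun k _ => ?_
    simp only [Pi.mul_apply, e]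
    split_ifs with hk
    · rcases eq_or_ne (σ (position k)) 0 with h0 | h0
      · simp [h0]
      · rw [← Complex.ofReal_mul]
        congr 1
        field_simp
    · simp

/-- Centering a positive semidefinite matrix halves the bound on its norm. -/
theorem norm_sub_half_norm_le {X : Matrix ι ι ℂ} (hX : X.PosSemidef) :
    ‖X - ((‖X‖ / 2 : ℝ) : ℂ) • (1 : Matrix ι ι ℂ)‖ ≤ ‖X‖ / 2 := by
  set U := hX.isHermitian.eigenvectorUnitary
  have hXU : X = conjDiag U _ := isHermitian_eq_conjDiag hX.isHermitian
  have hU : star (U : Matrix ι ι ℂ) * (U : Matrix ι ι ℂ) = 1 := Unitary.coe_star_mul_self U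
  have hle : ∀ k, hX.isHermitian.eigenvalues k ≤ ‖X‖ := fun k => by
    have h := norm_diagEntry_le U X k
    have h2 : diagEntry U X k = hX.isHermitian.eigenvalues k := by
      conv_lhs => rw [hXU]
      rw [diagEntry, conjDiag, mul_assoc, mul_assoc _ _ (U : Matrix ι ι ℂ), hU, mul_one, ← mul_assoc,
        hU, one_mul, diagonal_apply_eq]
    rw [h2, Complex.norm_real, Real.norm_eq_abs] at h
    exact (le_abs_self _).trans h
  have h3 : X - ((‖X‖ / 2 : ℝ) : ℂ) • (1 : Matrix ι ι ℂ) =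
      conjDiag U ((fun k => (hX.isHermitian.eigenvalues k : ℂ)) - ((‖X‖ / 2 : ℝ) : ℂ) • 1) := by
    rw [conjDiag_sub, conjDiag_smul, conjDiag_one, ← hXU]
  rw [h3]
  refine norm_conjDiag_le U (by positivity) fun k => ?_
  simp only [Pi.sub_apply, Pi.smul_apply, Pi.one_apply, smul_eq_mul, mul_one]
  rw [← Complex.ofReal_sub, Complex.norm_real, Real.norm_eq_abs, abs_le]
  have h4 := hX.eigenvalues_nonneg k
  have h5 := hle k
  constructor <;> linarith

/-! ### Singular values of the commutator -/

theorem sum_singularVector_commutator_le {A X : Matrix ι ι ℂ} (hA : A.IsHermitian)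
    (hX : X.IsHermitian) (j : ℕ) :
    ∑ i ∈ Finset.range j, extendZero (singularVector (A * X - X * A)) i ≤
      ∑ l ∈ Finset.range j, extendZero (spread hX) l * extendZero (spread hA) l := by
  obtain ⟨V, hV, hVj, hVC⟩ := exists_trace_mul_eq_sum_singularVector (A * X - X * A) j
  set N := Fintype.card ι
  set a := extendZero (spread hA)
  set x := extendZero (spread hX)
  have ha : ∀ l, N / 2 ≤ l → a l = 0 := fun l hl => extendZero_of_le _ hl
  have hx : ∀ l, N / 2 ≤ l → x l * a l = 0 := fun l hl => by rw [ha l hl, mul_zero]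
  have hdiff : ∀ l r : ℕ, ((min (l + 1) r : ℕ) : ℝ) - (min l r : ℕ) = if l < r then 1 else 0 := by
    intro l r
    split_ifs with h
    · rw [min_eq_left h, min_eq_left h.le]; simp
    · rw [min_eq_right (by omega), min_eq_right (not_lt.1 h), sub_self]
  have inner : ∀ (U : unitaryGroup ι ℂ) (i : ℕ),
      (spectralProj U i * (V * A - A * V)).trace.re ≤
        ∑ l ∈ Finset.range (min (min i (N - i)) j), a l := by
    intro U i
    rw [trace_mul_commutator, ← sum_range_mul_ite a (N / 2) _ ha]
    simp only [← hdiff]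
    refine re_trace_mul_le_sum_spread hA (trace_commutator _ _)
      (fun m => ((min m (min (min i (N - i)) j) : ℕ) : ℝ)) (by simp) fun W m => ?_
    have hone : ∀ (W : unitaryGroup ι ℂ) (m : ℕ), ‖spectralProj W m * V - V * spectralProj W m‖ ≤ 1 :=
      fun W m => (norm_spectralProj_commutator_le W m V).trans hV
    -- Rotating the trilinear trace puts either projection or `V` outside the commutator of the
    -- other two; each choice gives one of the three bounds.
    have b1 : (spectralProj W m * (spectralProj U i * V - V * spectralProj U i)).trace.re ≤
        (min m (N - m) : ℕ) := by
      refine (Complex.re_le_norm _).trans ((norm_trace_spectralProj_mul_le_of_trace_eq_zero W m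
        (trace_commutator _ _)).trans ?_)
      exact mul_le_of_le_one_right (Nat.cast_nonneg _) (hone U i)
    have b2 : (spectralProj W m * (spectralProj U i * V - V * spectralProj U i)).trace.re ≤
        (min i (N - i) : ℕ) := by
      rw [trace_mul_commutator, trace_mul_commutator]
      refine (Complex.re_le_norm _).trans ((norm_trace_spectralProj_mul_le_of_trace_eq_zero U i
        (trace_commutator _ _)).trans ?_)
      rw [norm_sub_rev]
      exact mul_le_of_le_one_right (Nat.cast_nonneg _) (hone W m)
    have b3 : (spectralProj W m * (spectralProj U i * V - V * spectralProj U i)).trace.re ≤ j := by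
      rw [trace_mul_commutator]
      refine (Complex.re_le_norm _).trans ((hVj _).trans ?_)
      refine mul_le_of_le_one_right (Nat.cast_nonneg _)
        ((norm_spectralProj_commutator_le W m _).trans (norm_conjDiag_le U zero_le_one fun k => ?_))
      split_ifs <;> simp
    simp only [Nat.cast_min] at b1 b2 ⊢
    exact le_min b1 (le_min b2 b3)
  have houter := re_trace_mul_le_sum_spread hX (trace_commutator V A)
    (fun m => ∑ l ∈ Finset.range (min m j), a l) (by simp) inner
  have hstep : ∀ l, ∑ i ∈ Finset.range (min (l + 1) j), a i - ∑ i ∈ Finset.range (min l j), a i =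
      a l * if l < j then 1 else 0 := by
    intro l
    split_ifs with h
    · rw [min_eq_left h, min_eq_left h.le, Finset.sum_range_succ]; ring
    · rw [min_eq_right (by omega), min_eq_right (not_lt.1 h)]; ring
  simp only [hstep, ← mul_assoc] at houter
  rw [sum_range_mul_ite (fun l => x l * a l) (N / 2) j hx, ← trace_mul_commutator, hVC,
    Complex.ofReal_re] at houter
  exact houter

theorem sum_singularVector_commutator_le_of_posSemidef {A X : Matrix ι ι ℂ} (hA : A.IsHermitian)
    (hX : X.PosSemidef) (j : ℕ) :
    ∑ i ∈ Finset.range j, extendZero (singularVector (A * X - X * A)) i ≤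
      ‖X‖ / 2 * ∑ l ∈ Finset.range j, extendZero (spread hA) (l / 2) := by
  obtain ⟨V, hV, hVj, hVC⟩ := exists_trace_mul_eq_sum_singularVector (A * X - X * A) j
  set N := Fintype.card ι
  set a := extendZero (spread hA)
  set c := ‖X‖ / 2 with hc
  have hc0 : 0 ≤ c := by positivity
  set Y := X - (c : ℂ) • (1 : Matrix ι ι ℂ) with hY
  have hYc : ‖Y‖ ≤ c := norm_sub_half_norm_le hX
  have hcomm : A * X - X * A = A * Y - Y * A := by
    simp only [hY, mul_sub, sub_mul, mul_smul_comm, smul_mul_assoc, mul_one, one_mul]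
    abel
  have hnorm : ‖Y * V - V * Y‖ ≤ 2 * c := by
    refine (norm_sub_le _ _).trans ?_
    have h1 := (norm_mul_le Y V).trans (mul_le_of_le_one_right (norm_nonneg Y) hV)
    have h2 := (norm_mul_le V Y).trans (mul_le_of_le_one_left (norm_nonneg Y) hV)
    linarith
  -- The term `m + m` comes from `‖[Y, V]‖ ≤ 2c`; the term `j` from rotating to `tr (V [P, Y])`,
  -- where the commutator has norm at most `c`.
  have key := re_trace_mul_le_sum_spread hA (trace_commutator Y V)
    (fun m => c * ((min (m + m) j : ℕ) : ℝ)) (by simp) (fun W m => by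
      have b1 : (spectralProj W m * (Y * V - V * Y)).trace.re ≤
          c * ((min m (Fintype.card ι - m) : ℕ) + (min m (Fintype.card ι - m) : ℕ)) := by
        refine (Complex.re_le_norm _).trans ((norm_trace_spectralProj_mul_le_of_trace_eq_zero W m
          (trace_commutator _ _)).trans ?_)
        refine (mul_le_mul_of_nonneg_left hnorm (Nat.cast_nonneg _)).trans_eq ?_
        ring
      have b2 : (spectralProj W m * (Y * V - V * Y)).trace.re ≤ c * j := by
        rw [trace_mul_commutator]
        refine (Complex.re_le_norm _).trans ((hVj _).trans ?_)
        rw [mul_comm]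
        gcongr
        exact (norm_spectralProj_commutator_le W m Y).trans hYc
      rw [Nat.cast_min, mul_min_of_nonneg _ _ hc0, Nat.cast_add]
      exact le_min b1 b2)
  -- The increment counts which of `2l`, `2l + 1` lie below `j`; this produces the doubled entries
  -- of `Spr⁺(A ⊕ A)`.
  have hstep : ∀ l : ℕ, c * ((min (l + 1 + (l + 1)) j : ℕ) : ℝ) - c * ((min (l + l) j : ℕ) : ℝ) =
      c * ((if l + l < j then 1 else 0) + if l + l + 1 < j then 1 else 0) := by
    intro l
    rw [← mul_sub]
    congr 1
    split_ifs with h1 h2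
    · rw [min_eq_left (by omega), min_eq_left (by omega)]; push_cast; ring
    · rw [min_eq_right (by omega), min_eq_left (by omega), show j = l + l + 1 by omega]
      push_cast; ring
    · omega
    · rw [min_eq_right (by omega), min_eq_right (by omega)]; ring
  have hpair : ∀ (F : ℕ → ℝ) (p : ℕ), ∑ k ∈ Finset.range (p + p), F k =
      ∑ l ∈ Finset.range p, (F (l + l) + F (l + l + 1)) := by
    intro F p
    induction p with
    | zero => simp
    | succ p ih =>
      rw [show p + 1 + (p + 1) = p + p + 1 + 1 by ring, Finset.sum_range_succ,
        Finset.sum_range_succ, ih, Finset.sum_range_succ]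
      ring
  rw [trace_mul_commutator, ← hcomm, hVC, Complex.ofReal_re] at key
  refine key.trans_eq ?_
  simp only [hstep]
  rw [← sum_range_mul_ite (fun l => a (l / 2)) (N / 2 + N / 2) j
    (fun l hl => extendZero_of_le _ (by omega)), hpair, Finset.mul_sum]
  refine Finset.sum_congr rfl fun l _ => ?_
  rw [show (l + l) / 2 = l by omega, show (l + l + 1) / 2 = l by omega]
  ring

end SpectralSpread

end

open SpectralSpread in
theorem corollary3p2 (n : ℕ) (A X : Matrix (Fin n) (Fin n) ℂ)
    (hA : A.IsHermitian) (hX : X.IsHermitian) :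
    SpectralSpread.Submajorized
      (SpectralSpread.singularVector (A * X - X * A))
      (SpectralSpread.entrywiseMul (SpectralSpread.spread hX)
        (SpectralSpread.spread (SpectralSpread.isHermitian_directSum hA hA))) ∧
    (X.PosSemidef →
      SpectralSpread.Submajorized
        (SpectralSpread.singularVector (A * X - X * A))
        (((1 / 2 : ℝ) * ‖Matrix.toEuclideanCLM (n := Fin n) (𝕜 := ℂ) X‖) •
          SpectralSpread.spread (SpectralSpread.isHermitian_directSum hA hA))) := by
  have hS := isHermitian_directSum hA hA
  refine ⟨submajorized_of_sum_le (singularVector_antitone _) (singularVector_nonneg _)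
    (fun i j hij => ?_) (fun i => mul_nonneg (spread_nonneg hX _) (spread_nonneg hS _))
    (fun j => ?_), fun hpos => submajorized_of_sum_le (singularVector_antitone _)
    (singularVector_nonneg _) (fun i j hij => ?_)
    (fun i => mul_nonneg (by positivity) (spread_nonneg hS _)) (fun j => ?_)⟩
  · exact mul_le_mul (spread_antitone hX hij) (spread_antitone hS hij) (spread_nonneg hS _)
      (spread_nonneg hX _)
  · refine (sum_singularVector_commutator_le hA hX j).trans (Finset.sum_le_sum fun l _ => ?_)
    rw [extendZero_entrywiseMul, spread_directSum_self hA]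
    -- Entry `l` of the spread of `A ⊕ A` is entry `l / 2` of that of `A`, hence at least its entry
    -- `l`.
    exact mul_le_mul_of_nonneg_left
      (extendZero_antitone (spread_antitone hA) (spread_nonneg hA) (Nat.div_le_self l 2))
      (extendZero_nonneg (spread_nonneg hX) l)
  · exact mul_le_mul_of_nonneg_left (spread_antitone hS hij) (by positivity)
  · refine (sum_singularVector_commutator_le_of_posSemidef hA hpos j).trans_eq ?_
    rw [Finset.mul_sum]
    refine Finset.sum_congr rfl fun l _ => ?_
    rw [← spread_directSum_self hA, Matrix.cstar_norm_def, extendZero, extendZero]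
    split_ifs
    · rw [Pi.smul_apply, smul_eq_mul]
      ring
    · simp
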